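/- **Definitions.** A point $x$ of a topological space $X$ is a *cut point* if $X\setminus\{x\}$ is disconnected (the union of two disjoint non-empty relatively open sets), and otherwise a *non-cut point*. A *dendrite* is a compact connected metrizable space in which any two distinct points $a,b$ are separated by some third point $c$, meaning that the complement of $c$ is the union of two disjoint open sets, one containing $a$ and the other containing $b$. A *Freudenthal compactification* of a locally compact Hausdorff space $X$ is a compact Hausdorff space $D$ together with an embedding $e:X\to D$ with dense image such that the remainder $D\setminus e(X)$ is zero-dimensional (it has a basis of clopen sets; it may be empty) and disjoint closed subsets of $X$ with compact boundaries have images with disjoint closures in $D$. **Theorem.** Let $X$ be a connected, separable, locally compact Hausdorff space with fewer than $\mathfrak c=|\mathbb R|$ non-cut points. Then: (i) $X$ embeds into a dendrite whose cut points are precisely the (images of the) cut points of $X$. In fact, $X$ has a Freudenthal compactification, and for every Freudenthal compactification $e:X\to D$ the space $D$ is a dendrite whose set of cut points is $e(\{\text{cut points of }X\})$. (ii) The set of non-cut points of $X$ is a $G_\delta$-subset of $X$, and if $X$ has more than one point, it is nowhere dense in $X$. -/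

import Mathlib

open Set TopologicalSpace

universe u v

/-- The set of cut points of a space: the points whose complement is disconnected, i.e. splits into
two disjoint nonempty relatively open sets.  (The empty set is not disconnected, so the point
of a one-point space is a non-cut point.) -/
def cutPoints (X : Type*) [TopologicalSpace X] : Set X :=
  {x | ¬ IsPreconnected ({x}ᶜ : Set X)}

/-- The set of non-cut points of a space. -/
def nonCutPoints (X : Type*) [TopologicalSpace X] : Set X :=
  (cutPoints X)ᶜ

/-- `a` and `b` are separated by `c`: the complement of `c` is the union of two disjoint open sets,
one containing `a` and the other containing `b`. -/
def SeparatedByPoint {X : Type*} [TopologicalSpace X] (a b c : X) : Prop :=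
  ∃ U V : Set X, IsOpen U ∧ IsOpen V ∧ Disjoint U V ∧ U ∪ V = {c}ᶜ ∧ a ∈ U ∧ b ∈ V

/-- A dendritic space: a connected space in which every two distinct points are separated by some
other point. -/
structure IsDendritic (X : Type*) [TopologicalSpace X] : Prop where
  connected : ConnectedSpace X
  separated : ∀ a b : X, a ≠ b → ∃ c : X, SeparatedByPoint a b c

/-- A dendron: a dendritic compact Hausdorff space. -/
structure IsDendron (X : Type*) [TopologicalSpace X] : Prop extends IsDendritic X where
  compact : CompactSpace X
  hausdorff : T2Space X

/-- A dendrite: a metrizable dendron. -/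
structure IsDendrite (X : Type*) [TopologicalSpace X] : Prop extends IsDendron X where
  metrizable : MetrizableSpace X

/-- `e : X → D` exhibits `D` as the Freudenthal compactification of `X`: `D` is a compact Hausdorff
space in which `X` is densely embedded by `e`, the remainder `D \ e(X)` is zero-dimensional (it has
a basis of relatively clopen sets), and disjoint closed subsets of `X` with compact boundaries have
disjoint closures in `D`. -/
structure IsFreudenthalCompactification {X D : Type*} [TopologicalSpace X] [TopologicalSpace D]
    (e : X → D) : Prop where
  compact : CompactSpace D
  hausdorff : T2Space D
  isEmbedding : Topology.IsEmbedding e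
  denseRange : DenseRange e
  remainder : IsTopologicalBasis {s : Set ↥((range e)ᶜ) | IsClopen s}
  disjoint_closure : ∀ A B : Set X, IsClosed A → IsClosed B → Disjoint A B →
    IsCompact (frontier A) → IsCompact (frontier B) →
    Disjoint (closure (e '' A)) (closure (e '' B))

/-! Everything rests on the sides of points, which behave like half-spaces in a tree: removing a
side from a connected set not contained in it leaves it connected, and finitely many sides (any
number, in a compact space) cover a connected space only if two of them do.

Let D be a Freudenthal compactification of X. The image of X is open in D, the remainder is totally
disconnected, and the cut points of D are those of X. If no point of D separates a from b, remove
every side missing both; the rest C is a connected closed set containing a and b. Each cut point in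
C other than a and b has a nonempty side missing C. These sides are disjoint and open, so by
separability there are countably many. But C meets the image of X in at least continuum many points,
too many for few non-cut points. Hence D is dendritic (`isDendritic_of_few_nonCutPoints`).

Metrizability (`IsDendron.secondCountable`) uses medians: any two points of a dendron are separated
by the median of a suitable triple from a countable dense set. Existence of D comes from evaluating
functions that are 0 or 1 off a compact set.

For (ii), a cut point of D is one separating two members of a countable dense set, which makes the
non-cut points a Gδ. Having fewer than continuum many members, those in X are countable, and Baire
category finishes. -/

/-- `V` is a side of the point `x`: an open set missing `x` which becomes closed by adding `x`,
i.e. a relatively clopen subset of the complement of `x`. -/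
structure IsSide {X : Type*} [TopologicalSpace X] (x : X) (V : Set X) : Prop where
  isOpen : IsOpen V
  notMem : x ∉ V
  isClosed : IsClosed (insert x V)

theorem insert_compl_insert {X : Type*} {V : Set X} {x : X} (hx : x ∉ V) :
    insert x (insert x V)ᶜ = Vᶜ := by
  ext z
  by_cases hz : z = x
  · simp [hz, hx]
  · simp [hz]

/-! ### Sides of points and their Helly property. -/

namespace IsSide

variable {X : Type*} [TopologicalSpace X] {x y : X} {V W A : Set X}

theorem compl (h : IsSide x V) : IsSide x (insert x V)ᶜ where
  isOpen := h.isClosed.isOpen_compl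
  notMem := by simp
  isClosed := by
    rw [insert_compl_insert h.notMem]
    exact h.isOpen.isClosed_compl

theorem union (h : IsSide x V) (h' : IsSide x W) : IsSide x (V ∪ W) where
  isOpen := h.isOpen.union h'.isOpen
  notMem := by simp [h.notMem, h'.notMem]
  isClosed := by
    rw [insert_union_distrib]
    exact h.isClosed.union h'.isClosed

/-- A preconnected set missing `x` which meets a side of `x` is contained in it. -/
theorem subset_of_meets (h : IsSide x V) (hA : IsPreconnected A) (hx : x ∉ A)
    (hm : (A ∩ V).Nonempty) : A ⊆ V := by
  refine hA.subset_left_of_subset_union h.isOpen h.compl.isOpen ?_ ?_ hm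
  · exact disjoint_left.2 fun z hz hz' => hz' (mem_insert_of_mem _ hz)
  · intro z hz
    by_cases hzV : z ∈ V
    · exact Or.inl hzV
    · refine Or.inr ?_
      rintro (rfl | h')
      · exact hx hz
      · exact hzV h'

/-- Removing a side from a preconnected set which is not contained in this side leaves it
preconnected. -/
theorem isPreconnected_diff (h : IsSide x V) (hA : IsPreconnected A) (hne : (A \ V).Nonempty) :
    IsPreconnected (A \ V) := by
  classical
  by_cases hx : x ∈ A
  -- Collapsing `V` to `x` is continuous because the frontier of `V` is at most `{x}`; it retracts
  -- `A` onto `A \ V`.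
  · have hcont : Continuous (V.piecewise (fun _ => x) id) := by
      refine Continuous.piecewise ?_ continuous_const continuous_id
      intro z hz
      have h1 : z ∈ insert x V := closure_minimal (subset_insert x V) h.isClosed hz.1
      have h2 : z ∉ V := fun hzV => hz.2 (by rwa [h.isOpen.interior_eq])
      rcases h1 with h1 | h1
      · exact h1.symm
      · exact absurd h1 h2
    have himg : V.piecewise (fun _ => x) id '' A = A \ V := by
      ext z
      constructor
      · rintro ⟨w, hw, rfl⟩
        by_cases hwV : w ∈ V
        · simpa [hwV] using ⟨hx, h.notMem⟩
        · simpa [hwV] using hw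
      · rintro ⟨hz, hzV⟩
        exact ⟨z, hz, by simp [hzV]⟩
    rw [← himg]
    exact hA.image _ hcont.continuousOn
  · have hdisj : A ∩ V = ∅ := by
      by_contra hcon
      have := h.subset_of_meets hA hx (nonempty_iff_ne_empty.2 hcon)
      obtain ⟨z, hz⟩ := hne
      exact hz.2 (this hz.1)
    have : A \ V = A := by
      rw [sdiff_eq_left]
      exact disjoint_iff_inter_eq_empty.2 hdisj
    rwa [this]

theorem isPreconnected_insert [PreconnectedSpace X] (h : IsSide x V) :
    IsPreconnected (insert x V) := by
  have := h.compl.isPreconnected_diff (A := univ) isPreconnected_univ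
    ⟨x, mem_univ _, h.compl.notMem⟩
  simpa [← compl_eq_univ_sdiff] using this

/-- Two sides which contain each other's base points cover the space. -/
theorem union_eq_univ [PreconnectedSpace X] (h : IsSide x V) (h' : IsSide y W) (hx : x ∈ W)
    (hy : y ∈ V) : V ∪ W = univ := by
  have hcl : IsClopen (V ∪ W) := by
    refine ⟨?_, h.isOpen.union h'.isOpen⟩
    have : V ∪ W = insert x V ∪ insert y W := by
      ext z
      simp only [mem_union, mem_insert_iff]
      constructor
      · tauto
      · rintro ((rfl | h1) | (rfl | h1)) <;> tauto
    rw [this]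
    exact h.isClosed.union h'.isClosed
  exact hcl.eq_univ ⟨x, Or.inr hx⟩

theorem subset_of_mem [PreconnectedSpace X] (h : IsSide x V) (h' : IsSide y W)
    (hne : V ∪ W ≠ univ) (hx : x ∈ W) : V ⊆ W := by
  have hy : y ∉ insert x V := by
    rintro (rfl | hy)
    · exact h'.notMem hx
    · exact hne (h.union_eq_univ h' hx hy)
  exact (subset_insert x V).trans
    (h'.subset_of_meets h.isPreconnected_insert hy ⟨x, mem_insert _ _, hx⟩)

/-- Two intersecting sides which do not cover the space are nested or have the same base point. -/
theorem nested_or_eq [PreconnectedSpace X] (h : IsSide x V) (h' : IsSide y W)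
    (hne : V ∪ W ≠ univ) (hm : (V ∩ W).Nonempty) : V ⊆ W ∨ W ⊆ V ∨ x = y := by
  by_cases hy : y ∈ insert x V
  · rcases hy with rfl | hy
    · exact Or.inr (Or.inr rfl)
    · exact Or.inr (Or.inl (h'.subset_of_mem h (by rwa [union_comm]) hy))
  · exact Or.inl ((subset_insert x V).trans (h'.subset_of_meets h.isPreconnected_insert hy
      (hm.mono (inter_subset_inter_left _ (subset_insert x V)))))

/-- A Helly property: finitely many sides, no two of which cover the space, do not cover it. -/
theorem exists_notMem_finset [PreconnectedSpace X] [Nonempty X] (S : Finset (Set X))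
    (hS : ∀ V ∈ S, ∃ x, IsSide x V) (hpair : ∀ V ∈ S, ∀ W ∈ S, V ∪ W ≠ univ) :
    ∃ z, ∀ V ∈ S, z ∉ V := by
  classical
  induction S using Finset.strongInduction with
  | H S ih =>
    rcases S.eq_empty_or_nonempty with rfl | ⟨V, hV⟩
    · exact ⟨Classical.arbitrary X, by simp⟩
    · obtain ⟨x, hx⟩ := hS V hV
      by_cases hex : ∃ W ∈ S, x ∈ W
      · obtain ⟨W, hW, hxW⟩ := hex
        obtain ⟨y, hy⟩ := hS W hW
        -- `V` lies inside `W`, so it may be dropped from the family; if no such `W` exists, the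
        -- base point `x` itself is uncovered.
        have hsub := hx.subset_of_mem hy (hpair V hV W hW) hxW
        obtain ⟨z, hz⟩ := ih (S.erase V) (Finset.erase_ssubset hV)
          (fun U hU => hS U (Finset.mem_of_mem_erase hU))
          (fun U hU U' hU' => hpair U (Finset.mem_of_mem_erase hU) U' (Finset.mem_of_mem_erase hU'))
        have hWV : W ≠ V := fun h => hx.notMem (h ▸ hxW)
        refine ⟨z, fun U hU => ?_⟩
        by_cases hUV : U = V
        · rw [hUV]
          exact fun hzV => hz W (Finset.mem_erase.2 ⟨hWV, hW⟩) (hsub hzV)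
        · exact hz U (Finset.mem_erase.2 ⟨hUV, hU⟩)
      · push Not at hex
        exact ⟨x, hex⟩

/-- In a compact space the Helly property of sides holds for arbitrary families. -/
theorem exists_notMem_sUnion [CompactSpace X] [ConnectedSpace X] (S : Set (Set X))
    (hS : ∀ V ∈ S, ∃ x, IsSide x V) (hpair : ∀ V ∈ S, ∀ W ∈ S, V ∪ W ≠ univ) :
    ∃ z, z ∉ ⋃₀ S := by
  classical
  by_contra! hcon
  choose x hx using hS
  obtain ⟨T, hT⟩ := isCompact_univ.elim_finite_subcover (fun V : S => (V : Set X))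
    (fun V => (hx V V.2).isOpen) (fun z _ => by simpa [sUnion_eq_iUnion] using hcon z)
  obtain ⟨z, hz⟩ := exists_notMem_finset (T.image Subtype.val)
    (fun V hV => by
      obtain ⟨W, -, rfl⟩ := Finset.mem_image.1 hV
      exact ⟨_, hx W W.2⟩)
    (fun V hV W hW => by
      obtain ⟨V, -, rfl⟩ := Finset.mem_image.1 hV
      obtain ⟨W, -, rfl⟩ := Finset.mem_image.1 hW
      exact hpair V V.2 W W.2)
  obtain ⟨V, hV, hzV⟩ := mem_iUnion₂.1 (hT (mem_univ z))
  exact hz V (Finset.mem_image_of_mem _ hV) hzV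

end IsSide

section

variable {X : Type*} [TopologicalSpace X]

theorem separatedByPoint_iff {a b c : X} :
    SeparatedByPoint a b c ↔ ∃ V, IsSide c V ∧ a ∈ V ∧ b ∉ insert c V := by
  constructor
  · rintro ⟨U, V, hU, hV, hd, huv, ha, hb⟩
    have h1 : insert c U = Vᶜ := by
      ext z
      have h2 : z ∈ U ∪ V ↔ z ≠ c := by rw [huv]; simp
      have h3 : z ∈ U → z ∉ V := fun h h' => disjoint_left.1 hd h h'
      simp only [mem_insert_iff, mem_compl_iff, mem_union] at *
      tauto
    refine ⟨U, ⟨hU, ?_, ?_⟩, ha, ?_⟩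
    · intro hc
      have : c ∈ ({c}ᶜ : Set X) := huv ▸ Or.inl hc
      simp at this
    · rw [h1]; exact hV.isClosed_compl
    · rw [h1]; simpa using hb
  · rintro ⟨V, hV, ha, hb⟩
    refine ⟨V, (insert c V)ᶜ, hV.isOpen, hV.compl.isOpen, ?_, ?_, ha, hb⟩
    · exact disjoint_left.2 fun z hz hz' => hz' (mem_insert_of_mem _ hz)
    · ext z
      have : z = c → z ∉ V := by rintro rfl; exact hV.notMem
      simp only [mem_union, mem_compl_iff, mem_insert_iff, mem_singleton_iff]
      tauto

theorem mem_cutPoints_iff [T1Space X] {x : X} :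
    x ∈ cutPoints X ↔ ∃ V, IsSide x V ∧ V.Nonempty ∧ (insert x V)ᶜ.Nonempty := by
  constructor
  · intro hx
    have hx' : ¬ IsPreconnected ({x}ᶜ : Set X) := hx
    rw [IsPreconnected] at hx'
    push Not at hx'
    obtain ⟨u, v, hu, hv, hsub, hmu, hmv, hempty⟩ := hx'
    have hc : (insert x ({x}ᶜ ∩ u))ᶜ = {x}ᶜ ∩ v := by
      ext z
      have h1 : z ≠ x → z ∈ u ∪ v := fun h => hsub h
      have h2 : ¬ (z ≠ x ∧ z ∈ u ∧ z ∈ v) := fun h => by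
        have : z ∈ {x}ᶜ ∩ (u ∩ v) := h
        rw [hempty] at this
        exact this
      simp only [mem_compl_iff, mem_insert_iff, mem_inter_iff, mem_singleton_iff, mem_union] at *
      tauto
    refine ⟨{x}ᶜ ∩ u, ⟨isOpen_compl_singleton.inter hu, by simp, ?_⟩, hmu, ?_⟩
    · rw [← isOpen_compl_iff, hc]
      exact isOpen_compl_singleton.inter hv
    · rwa [hc]
  · rintro ⟨V, hV, ⟨a, ha⟩, ⟨b, hb⟩⟩ hpre
    have := hV.subset_of_meets hpre (by simp)
      ⟨a, fun h => hV.notMem (h ▸ ha), ha⟩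
    exact hb (mem_insert_of_mem _ (this fun h => hb (h ▸ mem_insert _ _)))

end

namespace IsSide

variable {X : Type*} [TopologicalSpace X]

/-- Two intersecting sides whose closures miss `m` lie in a common such side. -/
theorem exists_union_subset [PreconnectedSpace X] {m x y : X} {V W : Set X} (h : IsSide x V)
    (h' : IsSide y W) (hm : m ∉ insert x V) (hm' : m ∉ insert y W) (hne : (V ∩ W).Nonempty) :
    ∃ d U, IsSide d U ∧ V ∪ W ⊆ U ∧ m ∉ insert d U := by
  have hcov : V ∪ W ≠ univ := fun hu => by
    rcases (hu ▸ mem_univ m : m ∈ V ∪ W) with h1 | h1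
    · exact hm (mem_insert_of_mem _ h1)
    · exact hm' (mem_insert_of_mem _ h1)
  rcases h.nested_or_eq h' hcov hne with h1 | h1 | rfl
  · exact ⟨y, W, h', union_subset h1 Subset.rfl, hm'⟩
  · exact ⟨x, V, h, union_subset Subset.rfl h1, hm⟩
  · refine ⟨x, V ∪ W, h.union h', Subset.rfl, ?_⟩
    simp only [mem_insert_iff, mem_union] at *
    tauto

end IsSide

/-! ### Dendritic spaces, medians, and second countability of separable dendrons. -/

theorem secondCountable_of_continuous_injective {X Y : Type*} [TopologicalSpace X]
    [TopologicalSpace Y] [CompactSpace X] [T2Space Y] [SecondCountableTopology Y] {f : X → Y}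
    (hf : Continuous f) (hi : Function.Injective f) : SecondCountableTopology X :=
  (hf.isClosedEmbedding hi).isInducing.secondCountableTopology

/-- A compact space with a countable family of open sets which separates points is second
countable. -/
theorem secondCountable_of_countable_separating {X : Type*} [tX : TopologicalSpace X] [CompactSpace X] (B : Set (Set X))
    (hB : B.Countable) (ho : ∀ U ∈ B, IsOpen U)
    (hsep : ∀ a b, a ≠ b → ∃ U ∈ B, ∃ V ∈ B, a ∈ U ∧ b ∈ V ∧ Disjoint U V) :
    SecondCountableTopology X := by
  -- The topology generated by `B` is coarser but still Hausdorff, so by compactness the identity is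
  -- an embedding.
  have hle : tX ≤ generateFrom B := le_generateFrom ho
  have ht2 : @T2Space X (generateFrom B) := @T2Space.mk X (generateFrom B) fun a b hab => by
    obtain ⟨U, hU, V, hV, ha, hb, hd⟩ := hsep a b hab
    exact ⟨U, V, isOpen_generateFrom_of_mem hU, isOpen_generateFrom_of_mem hV, ha, hb, hd⟩
  have hc : @Continuous X X tX (generateFrom B) id := continuous_id_iff_le.2 hle
  have : @SecondCountableTopology X (generateFrom B) :=
    @SecondCountableTopology.mk X (generateFrom B) ⟨B, hB, rfl⟩
  exact @secondCountable_of_continuous_injective X X tX (generateFrom B) _ ht2 this id hc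
    Function.injective_id

section

variable {X : Type*} [TopologicalSpace X]

theorem SeparatedByPoint.of_isPreconnected {a b c d m : X} {A B : Set X}
    (h : SeparatedByPoint a b m) (hA : IsPreconnected A) (hB : IsPreconnected B) (hmA : m ∉ A)
    (hmB : m ∉ B) (ha : a ∈ A) (hb : b ∈ B) (hc : c ∈ A) (hd : d ∈ B) :
    SeparatedByPoint c d m := by
  obtain ⟨W, hW, haW, hbW⟩ := separatedByPoint_iff.1 h
  exact separatedByPoint_iff.2 ⟨W, hW, hW.subset_of_meets hA hmA ⟨a, ha, haW⟩ hc,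
    hW.compl.subset_of_meets hB hmB ⟨b, hb, hbW⟩ hd⟩

theorem SeparatedByPoint.mem_of_isPreconnected {a b m : X} {A : Set X}
    (h : SeparatedByPoint a b m) (hA : IsPreconnected A) (ha : a ∈ A) (hb : b ∈ A) : m ∈ A := by
  by_contra hm
  obtain ⟨W, hW, haW, hbW⟩ := separatedByPoint_iff.1 h
  exact hbW (mem_insert_of_mem _ (hW.subset_of_meets hA hm ⟨a, ha, haW⟩ hb))

/-- In a dendritic space, two points which `m` does not separate lie in a common side whose closure
misses `m`. -/
theorem IsDendritic.exists_isSide_of_not_separated [T1Space X] (hX : IsDendritic X) {x y m : X}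
    (hx : x ≠ m) (hy : y ≠ m) (h : ¬ SeparatedByPoint x y m) :
    ∃ d V, IsSide d V ∧ x ∈ V ∧ y ∈ V ∧ m ∉ insert d V := by
  have := hX.connected
  -- Intersecting members of this family merge by `exists_union_subset`, so their union `T` is a
  -- side of `m`; if it missed `y`, then `m` would separate `x` from `y`.
  let T : Set X := {z | ∃ d V, IsSide d V ∧ x ∈ V ∧ z ∈ V ∧ m ∉ insert d V}
  have hself : ∀ z, z ≠ m → ∃ d V, IsSide d V ∧ z ∈ V ∧ m ∉ insert d V := fun z hz => by
    obtain ⟨d, hd⟩ := hX.separated z m hz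
    obtain ⟨V, hV, hz, hm⟩ := separatedByPoint_iff.1 hd
    exact ⟨d, V, hV, hz, hm⟩
  have hTo : IsOpen T := by
    rw [isOpen_iff_forall_mem_open]
    rintro z ⟨d, V, hV, hxV, hzV, hm⟩
    exact ⟨V, fun w hw => ⟨d, V, hV, hxV, hw, hm⟩, hV.isOpen, hzV⟩
  have hTm : m ∉ T := fun ⟨d, V, _, _, hmV, hm⟩ => hm (mem_insert_of_mem _ hmV)
  have hTc : IsOpen (insert m T)ᶜ := by
    rw [isOpen_iff_forall_mem_open]
    intro z hz
    have hzm : z ≠ m := fun h => hz (Or.inl h)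
    obtain ⟨d, V, hV, hzV, hm⟩ := hself z hzm
    refine ⟨V, ?_, hV.isOpen, hzV⟩
    rintro w hw (rfl | ⟨d', V', hV', hxV', hwV', hm'⟩)
    · exact hm (mem_insert_of_mem _ hw)
    · obtain ⟨e, U, hU, hsub, hmU⟩ := hV.exists_union_subset hV' hm hm' ⟨w, hw, hwV'⟩
      exact hz (Or.inr ⟨e, U, hU, hsub (Or.inr hxV'), hsub (Or.inl hzV), hmU⟩)
  by_contra hcon
  refine h (separatedByPoint_iff.2 ⟨T, ⟨hTo, hTm, ?_⟩, ?_, ?_⟩)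
  · rwa [← isOpen_compl_iff]
  · obtain ⟨d, V, hV, hxV, hm⟩ := hself x hx
    exact ⟨d, V, hV, hxV, hxV, hm⟩
  · rintro (h1 | h1)
    · exact hy h1
    · exact hcon h1

/-- A median of three points: a point all of whose sides contain two of the three points. -/
theorem exists_median [CompactSpace X] [ConnectedSpace X] (p q r : X) :
    ∃ m, ∀ d V, IsSide d V → m ∈ V → p ∈ V ∧ q ∈ V ∨ p ∈ V ∧ r ∈ V ∨ q ∈ V ∧ r ∈ V := by
  -- Two sides each containing at most one of the three points cannot cover all three, so the Helly
  -- property applies.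
  obtain ⟨m, hm⟩ := IsSide.exists_notMem_sUnion
    {V : Set X | (∃ d, IsSide d V) ∧ ¬ (p ∈ V ∧ q ∈ V ∨ p ∈ V ∧ r ∈ V ∨ q ∈ V ∧ r ∈ V)}
    (fun V hV => hV.1) (fun V hV W hW hu => by
      have hp := hu ▸ mem_univ p
      have hq := hu ▸ mem_univ q
      have hr := hu ▸ mem_univ r
      have h1 := hV.2
      have h2 := hW.2
      simp only [mem_union] at hp hq hr
      tauto)
  refine ⟨m, fun d V hV hmV => ?_⟩
  by_contra hcon
  exact hm ⟨V, ⟨⟨d, hV⟩, hcon⟩, hmV⟩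

/-- Between two points separated by a third one, there is room for two further separating points. -/
theorem IsDendritic.exists_disjoint_isSide [T1Space X] (hX : IsDendritic X) {a b : X}
    (hab : a ≠ b) : ∃ c U d V, IsSide c U ∧ IsSide d V ∧ a ∈ U ∧ b ∈ V ∧ Disjoint U V ∧
      c ∉ insert d V ∧ d ∉ insert c U ∧ (insert c U ∪ insert d V)ᶜ.Nonempty := by
  have := hX.connected
  obtain ⟨c, hc⟩ := hX.separated a b hab
  obtain ⟨U, hU, haU, hb⟩ := separatedByPoint_iff.1 hc
  have key : ∀ (a : X) (U : Set X), IsSide c U → a ∈ U →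
      ∃ d V, IsSide d V ∧ a ∈ V ∧ insert d V ⊆ U := by
    intro a U hU ha
    obtain ⟨d, hd⟩ := hX.separated a c (fun h => hU.notMem (h ▸ ha))
    obtain ⟨V, hV, haV, hc⟩ := separatedByPoint_iff.1 hd
    refine ⟨d, V, hV, haV, ?_⟩
    exact hU.subset_of_meets hV.isPreconnected_insert hc ⟨a, mem_insert_of_mem _ haV, ha⟩
  obtain ⟨d, V, hV, haV, hVU⟩ := key a U hU haU
  obtain ⟨e, W, hW, hbW, hWU⟩ := key b _ hU.compl hb
  have hdisj : Disjoint (insert d V) (insert e W) :=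
    disjoint_left.2 fun z hz hz' => hWU hz' (mem_insert_of_mem _ (hVU hz))
  refine ⟨d, V, e, W, hV, hW, haV, hbW, ?_, ?_, ?_, c, ?_⟩
  · exact hdisj.mono (subset_insert _ _) (subset_insert _ _)
  · exact disjoint_left.1 hdisj (mem_insert _ _)
  · exact disjoint_right.1 hdisj (mem_insert _ _)
  · rintro (h | h)
    · exact hU.notMem (hVU h)
    · exact hWU h (mem_insert _ _)

/-- Two distinct points `a` and `b` are separated by every median of three points which are suitably
placed with respect to them. -/
theorem IsDendritic.exists_separated_by_medians [T1Space X] (hX : IsDendritic X) {a b : X}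
    (hab : a ≠ b) : ∃ P Q R : Set X, IsOpen P ∧ IsOpen Q ∧ IsOpen R ∧
      P.Nonempty ∧ Q.Nonempty ∧ R.Nonempty ∧ ∀ p ∈ P, ∀ q ∈ Q, ∀ r ∈ R, ∀ m,
      (∀ d V, IsSide d V → m ∈ V → p ∈ V ∧ q ∈ V ∨ p ∈ V ∧ r ∈ V ∨ q ∈ V ∧ r ∈ V) →
      SeparatedByPoint a b m := by
  have := hX.connected
  obtain ⟨c, U, d, V, hU, hV, haU, hbV, hUV, hc, hd, hR⟩ := hX.exists_disjoint_isSide hab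
  refine ⟨U, V, (insert c U ∪ insert d V)ᶜ, hU.isOpen, hV.isOpen,
    (hU.isClosed.union hV.isClosed).isOpen_compl, ⟨a, haU⟩, ⟨b, hbV⟩, hR, ?_⟩
  intro p hp q hq r hr m hm
  have hcV : c ∉ V := fun h => hc (mem_insert_of_mem _ h)
  have hdU : d ∉ U := fun h => hd (mem_insert_of_mem _ h)
  have hrU : r ∉ U := fun h => hr (Or.inl (mem_insert_of_mem _ h))
  have hrV : r ∉ V := fun h => hr (Or.inr (mem_insert_of_mem _ h))
  have hqU : q ∉ U := disjoint_right.1 hUV hq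
  have hpV : p ∉ V := disjoint_left.1 hUV hp
  have hmU : m ∉ U := fun h => by have := hm c U hU h; tauto
  have hmV : m ∉ V := fun h => by have := hm d V hV h; tauto
  by_cases hmc : m = c
  · refine separatedByPoint_iff.2 ⟨U, hmc ▸ hU, haU, ?_⟩
    rintro (h | h)
    · rw [h, hmc] at hbV
      exact hcV hbV
    · exact disjoint_right.1 hUV hbV h
  by_cases hmd : m = d
  · refine separatedByPoint_iff.2 ⟨_, hmd ▸ hV.compl, ?_, ?_⟩
    · rintro (h | h)
      · rw [h, hmd] at haU
        exact hdU haU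
      · exact disjoint_left.1 hUV haU h
    · rw [hmd, insert_compl_insert hV.notMem]
      exact fun h => h hbV
  -- Otherwise some side `S` contains `c` and `d`, while the opposite side contains `m`, hence two
  -- of `p`, `q`, `r`, hence `p` or `q`. Being connected with its base point and avoiding `c` and
  -- `d`, it would drag `m` into `U` or `V`.
  have hsep : SeparatedByPoint c d m := by
    by_contra hcon
    obtain ⟨e, S, hS, hcS, hdS, hmS⟩ :=
      hX.exists_isSide_of_not_separated (Ne.symm hmc) (Ne.symm hmd) hcon
    have hT := hS.compl
    have key : ∀ (c p : X) (U : Set X), IsSide c U → p ∈ U → m ∉ U → c ∈ S →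
        p ∉ (insert e S)ᶜ := by
      intro c p U hU hp hmU hcS hpT
      refine hmU (hU.subset_of_meets hT.isPreconnected_insert ?_ ⟨p, mem_insert_of_mem _ hpT, hp⟩
        (mem_insert_of_mem _ hmS))
      rw [insert_compl_insert hS.notMem]
      exact fun h => h hcS
    have h1 := key c p U hU hp hmU hcS
    have h2 := key d q V hV hq hmV hdS
    have h3 := hm e _ hT hmS
    tauto
  exact hsep.of_isPreconnected hU.isPreconnected_insert hV.isPreconnected_insert (by simp [hmc, hmU])
    (by simp [hmd, hmV]) (mem_insert _ _) (mem_insert _ _) (mem_insert_of_mem _ haU)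
    (mem_insert_of_mem _ hbV)

/-- Only countably many medians of triples from a countable dense set occur. For each such median
and each dense pair it separates, one splitting of its complement is chosen; these countably many
open sets already separate all points. -/
theorem IsDendron.secondCountable [SeparableSpace X] (hX : IsDendron X) :
    SecondCountableTopology X := by
  have := hX.compact
  have := hX.hausdorff
  have := hX.connected
  have hD : IsDendritic X := hX.toIsDendritic
  choose med hmed using exists_median (X := X)
  obtain ⟨Q, hQc, hQd⟩ := exists_countable_dense X
  have := hQc.to_subtype
  have hch : ∀ t : (Q × Q × Q) × Q × Q, ∃ W : Set X × Set X, IsOpen W.1 ∧ IsOpen W.2 ∧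
      Disjoint W.1 W.2 ∧ (SeparatedByPoint (t.2.1 : X) (t.2.2 : X)
        (med t.1.1 t.1.2.1 t.1.2.2) → W.1 ∪ W.2 = {med t.1.1 t.1.2.1 t.1.2.2}ᶜ ∧
          (t.2.1 : X) ∈ W.1 ∧ (t.2.2 : X) ∈ W.2) := fun t => by
    by_cases h : SeparatedByPoint (t.2.1 : X) (t.2.2 : X) (med t.1.1 t.1.2.1 t.1.2.2)
    · obtain ⟨U, V, hU, hV, hd, hu, ha, hb⟩ := h
      exact ⟨(U, V), hU, hV, hd, fun _ => ⟨hu, ha, hb⟩⟩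
    · exact ⟨(∅, ∅), isOpen_empty, isOpen_empty, disjoint_bot_left, fun h' => absurd h' h⟩
  choose W hW1 hW2 hWd hW using hch
  refine secondCountable_of_countable_separating
    (range (fun t => (W t).1) ∪ range (fun t => (W t).2))
    ((countable_range _).union (countable_range _)) ?_ ?_
  · rintro _ (⟨t, rfl⟩ | ⟨t, rfl⟩)
    exacts [hW1 t, hW2 t]
  · intro a b hab
    obtain ⟨c, U, d, V, hU, hV, haU, hbV, hUV, hc, hd, -⟩ := hD.exists_disjoint_isSide hab
    have hcd : c ≠ d := fun h => hc (Or.inl h)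
    obtain ⟨P', Q', R', hP, hQ, hR, hPn, hQn, hRn, hmain⟩ := hD.exists_separated_by_medians hcd
    obtain ⟨p, hpQ, hpP⟩ := hQd.exists_mem_open hP hPn
    obtain ⟨q, hqQ, hqP⟩ := hQd.exists_mem_open hQ hQn
    obtain ⟨r, hrQ, hrP⟩ := hQd.exists_mem_open hR hRn
    obtain ⟨s, hsQ, hsU⟩ := hQd.exists_mem_open hU.isOpen ⟨a, haU⟩
    obtain ⟨t, htQ, htV⟩ := hQd.exists_mem_open hV.isOpen ⟨b, hbV⟩
    have hm := hmain p hpP q hqP r hrP (med p q r) (hmed p q r)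
    set m := med p q r with hmdef
    have hmU : m ∉ insert c U := by
      rintro (h | h)
      · obtain ⟨W, hW, hcW, -⟩ := separatedByPoint_iff.1 hm
        exact hW.notMem (h ▸ hcW)
      · have h1 := hU.compl.isPreconnected_insert
        rw [insert_compl_insert hU.notMem] at h1
        exact hm.mem_of_isPreconnected h1 hU.notMem (fun h => hd (mem_insert_of_mem _ h)) h
    have hmV : m ∉ insert d V := by
      rintro (h | h)
      · obtain ⟨W, hW, -, hdW⟩ := separatedByPoint_iff.1 hm
        exact hdW (h ▸ mem_insert _ _)
      · have h1 := hV.compl.isPreconnected_insert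
        rw [insert_compl_insert hV.notMem] at h1
        exact hm.mem_of_isPreconnected h1 (fun h => hc (mem_insert_of_mem _ h)) hV.notMem h
    -- The dense points `s` and `t` stand in for `a` and `b`: `insert c U` and `insert d V` are
    -- connected and miss `m`, so any splitting at `m` treats `s` like `a` and `t` like `b`.
    have hst : SeparatedByPoint s t m :=
      hm.of_isPreconnected hU.isPreconnected_insert hV.isPreconnected_insert hmU hmV
        (mem_insert _ _) (mem_insert _ _) (mem_insert_of_mem _ hsU) (mem_insert_of_mem _ htV)
    let T : (Q × Q × Q) × Q × Q := ((⟨p, hpQ⟩, ⟨q, hqQ⟩, ⟨r, hrQ⟩), ⟨s, hsQ⟩, ⟨t, htQ⟩)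
    obtain ⟨hu, hsW, htW⟩ := hW T hst
    refine ⟨_, Or.inl ⟨T, rfl⟩, _, Or.inr ⟨T, rfl⟩, ?_, ?_, hWd T⟩
    · refine hU.isPreconnected_insert.subset_left_of_subset_union (hW1 T) (hW2 T) (hWd T) ?_
        ⟨s, mem_insert_of_mem _ hsU, hsW⟩ (mem_insert_of_mem _ haU)
      rw [hu]
      exact fun z hz (h : z = m) => hmU (h ▸ hz)
    · refine hV.isPreconnected_insert.subset_right_of_subset_union (hW1 T) (hW2 T) (hWd T) ?_
        ⟨t, mem_insert_of_mem _ htV, htW⟩ (mem_insert_of_mem _ hbV)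
      rw [hu]
      exact fun z hz (h : z = m) => hmV (h ▸ hz)

end

/-! ### Few non-cut points make a continuum dendritic. -/

section

variable {X : Type*} [TopologicalSpace X]

theorem IsSide.isPreconnected_compl_biUnion [PreconnectedSpace X] {a : X} (S : Finset (Set X))
    (hS : ∀ V ∈ S, ∃ x, IsSide x V) (ha : ∀ V ∈ S, a ∉ V) : IsPreconnected (⋃ V ∈ S, V)ᶜ := by
  classical
  induction S using Finset.induction with
  | empty => simpa using isPreconnected_univ
  | insert V S _ ih =>
    obtain ⟨x, hx⟩ := hS V (Finset.mem_insert_self _ _)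
    have h1 : (⋃ W ∈ insert V S, W)ᶜ = (⋃ W ∈ S, W)ᶜ \ V := by
      rw [Finset.set_biUnion_insert, compl_union, inter_comm, sdiff_eq]
    rw [h1]
    refine hx.isPreconnected_diff (ih (fun W hW => hS W (Finset.mem_insert_of_mem hW))
      (fun W hW => ha W (Finset.mem_insert_of_mem hW))) ⟨a, ?_, ha V (Finset.mem_insert_self _ _)⟩
    simp only [mem_compl_iff, mem_iUnion, not_exists]
    exact fun W hW => ha W (Finset.mem_insert_of_mem hW)

/-- In a Hausdorff continuum, removing sides which all miss a point `a` leaves a preconnected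
set. -/
theorem IsSide.isPreconnected_compl_sUnion [CompactSpace X] [T2Space X] [PreconnectedSpace X]
    {a : X} (S : Set (Set X)) (hS : ∀ V ∈ S, ∃ x, IsSide x V) (ha : ∀ V ∈ S, a ∉ V) :
    IsPreconnected (⋃₀ S)ᶜ := by
  classical
  choose x hx using hS
  have hcl : IsClosed (⋃₀ S)ᶜ := (isOpen_sUnion fun V hV => (hx V hV).isOpen).isClosed_compl
  rw [isPreconnected_iff_subset_of_fully_disjoint_closed hcl]
  intro u v hu hv huv hd
  -- By compactness, finitely many of the sides already cover everything outside `u' ∪ v'`, which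
  -- reduces the claim to a finite family.
  obtain ⟨u', v', hu', hv', huu, hvv, hd'⟩ := normal_separation hu hv hd
  obtain ⟨T, hT⟩ := (hu'.union hv').isClosed_compl.isCompact.elim_finite_subcover
    (fun V : S => (V : Set X)) (fun V => (hx V V.2).isOpen) (fun z hz => by
      rw [← sUnion_eq_iUnion]
      by_contra hcon
      exact hz ((huv hcon).imp (fun h => huu h) (fun h => hvv h)))
  have hpre := IsSide.isPreconnected_compl_biUnion (a := a) (T.image Subtype.val)
    (fun V hV => by
      obtain ⟨W, -, rfl⟩ := Finset.mem_image.1 hV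
      exact ⟨_, hx W W.2⟩)
    (fun V hV => by
      obtain ⟨W, -, rfl⟩ := Finset.mem_image.1 hV
      exact ha W W.2)
  have hsub : (⋃ V ∈ T.image Subtype.val, V)ᶜ ⊆ u' ∪ v' := by
    rw [compl_subset_comm]
    intro z hz
    obtain ⟨V, hV, hzV⟩ := mem_iUnion₂.1 (hT hz)
    exact mem_iUnion₂.2 ⟨V, Finset.mem_image_of_mem _ hV, hzV⟩
  have hC : (⋃₀ S)ᶜ ⊆ (⋃ V ∈ T.image Subtype.val, V)ᶜ := by
    refine compl_subset_compl.2 (iUnion₂_subset fun V hV => ?_)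
    obtain ⟨W, -, rfl⟩ := Finset.mem_image.1 hV
    exact subset_sUnion_of_mem W.2
  by_cases hm : ((⋃ V ∈ T.image Subtype.val, V)ᶜ ∩ u').Nonempty
  · have h1 := hC.trans (hpre.subset_left_of_subset_union hu' hv' hd' hsub hm)
    exact Or.inl fun z hz => (huv hz).resolve_right fun h => disjoint_left.1 hd' (h1 hz) (hvv h)
  · refine Or.inr fun z hz => (huv hz).resolve_left fun h => hm ⟨z, hC hz, huu h⟩

/-- A nonempty relatively open subset of a nondegenerate connected set in a normal Hausdorff space
has at least the cardinality of the continuum. -/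
theorem IsPreconnected.continuum_le_mk_inter {X : Type u} [TopologicalSpace X] [T4Space X]
    {C O : Set X} (hC : IsPreconnected C) (hO : IsOpen O) {p q : X} (hp : p ∈ C ∩ O) (hq : q ∈ C)
    (hpq : p ≠ q) : Cardinal.continuum.{u} ≤ Cardinal.mk ↥(C ∩ O) := by
  -- By connectedness `f` takes every value of (0,1) on `C`, and only inside `O`, since `f` is 1
  -- elsewhere.
  obtain ⟨f, hf0, hf1, -⟩ := exists_continuous_zero_one_of_isClosed (isClosed_singleton (x := p))
    (hO.isClosed_compl.union (isClosed_singleton (x := q))) (by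
      rw [disjoint_singleton_left]
      rintro (h | h)
      · exact h hp.2
      · exact hpq h)
  have hsub : Ioo (0 : ℝ) 1 ⊆ f '' (C ∩ O) := by
    intro t ht
    have h0 : f p = 0 := hf0 rfl
    have h1 : f q = 1 := hf1 (Or.inr rfl)
    have hI : Icc (f p) (f q) ⊆ f '' C :=
      (hC.image f f.continuous.continuousOn).Icc_subset (mem_image_of_mem f hp.1)
        (mem_image_of_mem f hq)
    obtain ⟨z, hz, rfl⟩ := hI (by rw [h0, h1]; exact ⟨ht.1.le, ht.2.le⟩)
    refine ⟨z, ⟨hz, ?_⟩, rfl⟩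
    by_contra hzO
    have : f z = 1 := hf1 (Or.inl hzO)
    exact ht.2.ne this
  have h1 : Cardinal.mk (Ioo (0 : ℝ) 1) = Cardinal.continuum := Cardinal.mk_Ioo_real zero_lt_one
  have h2 := Cardinal.mk_image_le_lift (f := f) (s := C ∩ O)
  have h3 := Cardinal.lift_le.{u}.2 (Cardinal.mk_le_mk_of_subset hsub)
  rw [h1] at h3
  simpa using h3.trans h2

/-- Sides `V z` of the points `z` of a set are disjoint if they miss this set. -/
theorem IsSide.pairwiseDisjoint [PreconnectedSpace X] {Z : Set X} {V : X → Set X}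
    (hV : ∀ z ∈ Z, IsSide z (V z)) (hZ : ∀ z ∈ Z, ∀ w ∈ Z, w ∉ V z) :
    Z.PairwiseDisjoint V := by
  intro z hz w hw hzw
  refine disjoint_iff_inter_eq_empty.2 (not_nonempty_iff_eq_empty.1 fun hne => ?_)
  have h1 : w ∉ insert z (V z) := by
    rintro (h | h)
    · exact hzw h.symm
    · exact hZ z hz w hw h
  exact hZ w hw z hz ((hV w hw).subset_of_meets (hV z hz).isPreconnected_insert h1
    (hne.mono (inter_subset_inter_left _ (subset_insert _ _))) (mem_insert _ _))

/-- A separable Hausdorff continuum is dendritic as soon as it has an open subset with fewer than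
continuum many non-cut points whose complement is totally disconnected. -/
theorem isDendritic_of_few_nonCutPoints {X : Type u} [TopologicalSpace X] [CompactSpace X]
    [T2Space X] [ConnectedSpace X] [SeparableSpace X] {O : Set X} (hO : IsOpen O)
    (htd : IsTotallyDisconnected Oᶜ)
    (hcard : Cardinal.mk ↥(O \ cutPoints X) < Cardinal.continuum.{u}) : IsDendritic X := by
  refine ⟨inferInstance, fun a b hab => ?_⟩
  by_contra! hcon
  let S : Set (Set X) := {V | (∃ x, IsSide x V) ∧ a ∉ V ∧ b ∉ V}
  have hpre : IsPreconnected (⋃₀ S)ᶜ :=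
    IsSide.isPreconnected_compl_sUnion (a := a) S (fun V hV => hV.1) (fun V hV => hV.2.1)
  have haC : a ∈ (⋃₀ S)ᶜ := fun ⟨V, hV, h⟩ => hV.2.1 h
  have hbC : b ∈ (⋃₀ S)ᶜ := fun ⟨V, hV, h⟩ => hV.2.2 h
  obtain ⟨p, hpC, hpO⟩ : ((⋃₀ S)ᶜ ∩ O).Nonempty := by
    by_contra h
    refine hab (htd (⋃₀ S)ᶜ (fun z hz hzO => h ⟨z, hz, hzO⟩) hpre haC hbC)
  obtain ⟨q, hqC, hpq⟩ : ∃ q ∈ (⋃₀ S)ᶜ, p ≠ q := by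
    by_cases h : p = a
    · exact ⟨b, hbC, h ▸ hab⟩
    · exact ⟨a, haC, h⟩
  have hge := hpre.continuum_le_mk_inter hO ⟨hpC, hpO⟩ hqC hpq
  let Z : Set X := ((⋃₀ S)ᶜ ∩ cutPoints X) \ {a, b}
  -- As `z` does not separate `a` from `b`, one of the two sides given by a splitting at `z` misses
  -- both.
  have hside : ∀ z : X, z ∈ Z → ∃ V, IsSide z V ∧ V.Nonempty ∧ a ∉ V ∧ b ∉ V := by
    rintro z ⟨⟨hzC, hzcut⟩, hzab⟩
    have hza : a ≠ z := fun h => hzab (Or.inl h.symm)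
    have hzb : b ≠ z := fun h => hzab (Or.inr h.symm)
    obtain ⟨V, hV, hne, hne'⟩ := mem_cutPoints_iff.1 hzcut
    by_cases haV : a ∈ V
    · have hbV : b ∈ insert z V := by
        by_contra h
        exact hcon z (separatedByPoint_iff.2 ⟨V, hV, haV, h⟩)
      exact ⟨_, hV.compl, hne', fun h => h (mem_insert_of_mem _ haV), fun h => h hbV⟩
    · refine ⟨V, hV, hne, haV, fun hbV => hcon z ?_⟩
      refine separatedByPoint_iff.2 ⟨_, hV.compl, ?_, ?_⟩
      · rintro (h | h)
        exacts [hza h, haV h]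
      · rw [insert_compl_insert hV.notMem]
        exact fun h => h hbV
  choose! V hV hne haV hbV using hside
  have hZc : Z.Countable := by
    refine (IsSide.pairwiseDisjoint hV (fun z hz w hw hwV => ?_)).countable_of_isOpen
      (fun z hz => (hV z hz).isOpen) hne
    exact hw.1.1 ⟨V z, ⟨⟨z, hV z hz⟩, haV z hz, hbV z hz⟩, hwV⟩
  have hsub : (⋃₀ S)ᶜ ∩ O ⊆ (O \ cutPoints X) ∪ (Z ∪ {a, b}) := by
    intro z hz
    by_cases h1 : z ∈ cutPoints X
    · by_cases h2 : z ∈ ({a, b} : Set X)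
      · exact Or.inr (Or.inr h2)
      · exact Or.inr (Or.inl ⟨⟨hz.1, h1⟩, h2⟩)
    · exact Or.inl ⟨hz.2, h1⟩
  have hcount : (Z ∪ {a, b}).Countable := hZc.union (toFinite _).countable
  refine not_lt_of_ge (hge.trans (Cardinal.mk_le_mk_of_subset hsub)) ?_
  exact (Cardinal.mk_union_le _ _).trans_lt (Cardinal.add_lt_of_lt Cardinal.aleph0_le_continuum
    hcard ((Cardinal.le_aleph0_iff_set_countable.2 hcount).trans_lt Cardinal.aleph0_lt_continuum))

end

/-! ### Freudenthal compactifications: cut points and the dendrite property. -/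

section

variable {X : Type*} [TopologicalSpace X]

/-- Outside `K` the set agrees with the open set `V`, so its frontier is confined to `K`. This
produces the compact boundaries needed by `disjoint_closure`. -/
theorem IsSide.isCompact_frontier_diff {x : X} {V K : Set X} (h : IsSide x V) (hK : IsCompact K)
    (hKc : IsClosed K) (hx : x ∈ interior K) :
    IsCompact (frontier (insert x V \ interior K)) := by
  refine hK.of_isClosed_subset isClosed_frontier fun z hz => ?_
  by_contra hzK
  have hcl : IsClosed (insert x V \ interior K) := h.isClosed.sdiff isOpen_interior
  rw [hcl.frontier_eq] at hz
  rcases hz.1.1 with h1 | h1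
  · exact hzK (interior_subset (h1 ▸ hx))
  · exact hz.2 (mem_interior.2 ⟨V \ K, fun w hw =>
      ⟨mem_insert_of_mem _ hw.1, fun h => hw.2 (interior_subset h)⟩, h.isOpen.sdiff hKc, h1, hzK⟩)

/-- A dense subspace of a Hausdorff space which is locally compact is open. -/
theorem Topology.IsEmbedding.isOpen_range_of_dense {D : Type*} [TopologicalSpace D] [T2Space D]
    [LocallyCompactSpace X] {e : X → D} (he : Topology.IsEmbedding e) (hd : DenseRange e) :
    IsOpen (range e) := by
  rw [isOpen_iff_forall_mem_open]
  rintro _ ⟨x, rfl⟩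
  obtain ⟨K, hK, hxK⟩ := exists_compact_mem_nhds x
  obtain ⟨W, hW, hWK⟩ := he.isInducing.isOpen_iff.1 (isOpen_interior (s := K))
  refine ⟨W, ?_, hW, ?_⟩
  · refine (hd.open_subset_closure_inter hW).trans ?_
    refine (closure_minimal ?_ (hK.image he.continuous).isClosed).trans (image_subset_range e K)
    rintro _ ⟨hz, y, rfl⟩
    have hy : y ∈ e ⁻¹' W := hz
    rw [hWK] at hy
    exact mem_image_of_mem e (interior_subset hy)
  · change x ∈ e ⁻¹' W
    rw [hWK]
    exact mem_interior_iff_mem_nhds.2 hxK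

namespace IsFreudenthalCompactification

variable {D : Type*} [TopologicalSpace D] {e : X → D}

theorem isTotallyDisconnected (h : IsFreudenthalCompactification e) :
    IsTotallyDisconnected (range e)ᶜ := by
  have := h.hausdorff
  rw [← totallyDisconnectedSpace_subtype_iff]
  have : TotallySeparatedSpace ↥(range e)ᶜ :=
    totallySeparatedSpace_iff_exists_isClopen.2 fun x y hxy => ?_
  · infer_instance
  obtain ⟨U, hU, hxU, hUy⟩ := h.remainder.mem_nhds_iff.1
    (isOpen_compl_singleton.mem_nhds (show x ∈ ({y}ᶜ : Set _) from hxy))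
  exact ⟨U, hU, hxU, fun hy => hUy hy rfl⟩

/-- Once a small neighbourhood of `x` is cut out, the two pieces are disjoint closed sets with
compact frontiers, so their closures in `D` are disjoint. A common limit other than `e x` would
survive the cutting. -/
theorem closure_inter_closure [LocallyCompactSpace X] [T2Space X]
    (h : IsFreudenthalCompactification e) {x : X} {V : Set X} (hV : IsSide x V) :
    closure (e '' insert x V) ∩ closure (e '' Vᶜ) ⊆ {e x} := by
  have := h.hausdorff
  have := h.compact
  rintro p ⟨hpA, hpB⟩
  by_contra hpx
  obtain ⟨G, hG, hxG, hpG⟩ : ∃ G, IsClosed G ∧ e x ∈ interior G ∧ p ∉ G := by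
    obtain ⟨G, hG, hGc, hGp⟩ := exists_mem_nhds_isClosed_subset
      (isOpen_compl_singleton.mem_nhds (show e x ∈ ({p}ᶜ : Set D) from fun h => hpx h.symm))
    exact ⟨G, hGc, mem_interior_iff_mem_nhds.2 hG, fun hp => hGp hp rfl⟩
  obtain ⟨K, hK, hxK, hKG⟩ := exists_compact_subset
    (isOpen_interior.preimage h.isEmbedding.continuous) hxG
  have key : ∀ A : Set X, p ∈ closure (e '' A) → p ∈ closure (e '' (A \ interior K)) := by
    intro A hp
    have hsub : e '' A ⊆ e '' (A \ interior K) ∪ G := by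
      rintro _ ⟨y, hy, rfl⟩
      by_cases hyK : y ∈ interior K
      · exact Or.inr (interior_subset (hKG (interior_subset hyK)))
      · exact Or.inl ⟨y, ⟨hy, hyK⟩, rfl⟩
    have := closure_mono hsub hp
    rw [closure_union, hG.closure_eq] at this
    exact this.resolve_right hpG
  have hB := hV.compl
  have hfA := hV.isCompact_frontier_diff hK hK.isClosed hxK
  have hfB := hB.isCompact_frontier_diff hK hK.isClosed hxK
  have hcB := hB.isClosed
  rw [insert_compl_insert hV.notMem] at hfB hcB
  refine disjoint_left.1 (h.disjoint_closure _ _ (hV.isClosed.sdiff isOpen_interior)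
    (hcB.sdiff isOpen_interior) ?_ hfA hfB) (key _ hpA) (key _ hpB)
  refine disjoint_left.2 ?_
  rintro z ⟨rfl | hz, hzK⟩ ⟨hz', -⟩
  · exact hzK hxK
  · exact hz' hz

/-- The Freudenthal compactification has the same cut points. -/
theorem cutPoints_eq [LocallyCompactSpace X] [T2Space X] [ConnectedSpace X]
    (h : IsFreudenthalCompactification e) : cutPoints D = e '' cutPoints X := by
  have := h.hausdorff
  have := h.compact
  have he := h.isEmbedding
  apply Subset.antisymm
  · intro p hp
    by_cases hpe : p ∈ range e
    · obtain ⟨x, rfl⟩ := hpe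
      refine ⟨x, ?_, rfl⟩
      obtain ⟨V, hV, hne, hne'⟩ := mem_cutPoints_iff.1 hp
      have hins : insert x (e ⁻¹' V) = e ⁻¹' (insert (e x) V) := by
        ext y
        simp [he.injective.eq_iff]
      refine mem_cutPoints_iff.2 ⟨e ⁻¹' V, ⟨hV.isOpen.preimage he.continuous, hV.notMem, ?_⟩, ?_, ?_⟩
      · rw [hins]
        exact hV.isClosed.preimage he.continuous
      · obtain ⟨y, hy⟩ := h.denseRange.exists_mem_open hV.isOpen hne
        exact ⟨y, hy⟩
      · obtain ⟨y, hy⟩ := h.denseRange.exists_mem_open hV.compl.isOpen hne'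
        rw [hins]
        exact ⟨y, hy⟩
    · refine absurd ?_ hp
      -- A remainder point never cuts: its complement lies between the connected set `range e` and
      -- the closure of that set.
      have hr : IsPreconnected (range e) := isPreconnected_range he.continuous
      refine hr.subset_closure ?_ (fun z _ => h.denseRange z)
      rintro z hz rfl
      exact hpe hz
  · rintro _ ⟨x, hx, rfl⟩
    obtain ⟨V, hV, ⟨v, hv⟩, ⟨w, hw⟩⟩ := mem_cutPoints_iff.1 hx
    have hint := h.closure_inter_closure hV
    have hun : closure (e '' insert x V) ∪ closure (e '' Vᶜ) = univ := by
      have h1 : insert x V ∪ Vᶜ = univ := by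
        ext z
        simp only [mem_union, mem_insert_iff, mem_compl_iff, mem_univ, iff_true]
        tauto
      rw [← closure_union, ← image_union, h1, image_univ]
      exact h.denseRange.closure_range
    have hxA : e x ∈ closure (e '' insert x V) := subset_closure ⟨x, mem_insert _ _, rfl⟩
    have hxB : e x ∈ closure (e '' Vᶜ) := subset_closure ⟨x, hV.notMem, rfl⟩
    -- The two closures cover `D` and meet only in `e x`, so the complement of either one is a side
    -- of `e x`.
    have hins : insert (e x) (closure (e '' Vᶜ))ᶜ = closure (e '' insert x V) := by
      ext z
      have h1 : z ∈ closure (e '' insert x V) ∪ closure (e '' Vᶜ) := hun ▸ mem_univ z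
      have h2 : z ∈ closure (e '' insert x V) → z ∈ closure (e '' Vᶜ) → z = e x :=
        fun h h' => hint ⟨h, h'⟩
      have h3 : z = e x → z ∈ closure (e '' insert x V) := fun h => h ▸ hxA
      rw [mem_union] at h1
      rw [mem_insert_iff, mem_compl_iff]
      tauto
    refine mem_cutPoints_iff.2 ⟨(closure (e '' Vᶜ))ᶜ,
      ⟨isClosed_closure.isOpen_compl, fun hn => hn hxB, ?_⟩, ⟨e v, fun hv' => ?_⟩, ⟨e w, ?_⟩⟩
    · rw [hins]
      exact isClosed_closure
    · have := he.injective (hint ⟨subset_closure ⟨v, mem_insert_of_mem _ hv, rfl⟩, hv'⟩)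
      exact hV.notMem (this ▸ hv)
    · rw [hins]
      intro hw'
      have := he.injective (hint ⟨hw', subset_closure ⟨w, fun h => hw (mem_insert_of_mem _ h), rfl⟩⟩)
      exact hw (this ▸ mem_insert _ _)

theorem isDendrite {X : Type u} {D : Type v} [TopologicalSpace X] [TopologicalSpace D]
    {e : X → D} [LocallyCompactSpace X] [T2Space X] [ConnectedSpace X] [SeparableSpace X]
    (h : IsFreudenthalCompactification e)
    (hX : Cardinal.mk ↥(nonCutPoints X) < Cardinal.continuum.{u}) : IsDendrite D := by
  have := h.hausdorff
  have := h.compact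
  have : SeparableSpace D := h.denseRange.separableSpace h.isEmbedding.continuous
  have : ConnectedSpace D := by
    have : PreconnectedSpace D := h.denseRange.preconnectedSpace h.isEmbedding.continuous
    have : Nonempty D := (inferInstance : Nonempty X).map e
    exact ConnectedSpace.mk ‹_›
  have hE : range e \ cutPoints D = e '' nonCutPoints X := by
    rw [h.cutPoints_eq, nonCutPoints, image_compl_eq_range_sdiff_image h.isEmbedding.injective]
  have hcard : Cardinal.mk ↥(range e \ cutPoints D) < Cardinal.continuum.{v} := by
    have h1 : Cardinal.lift.{u} (Cardinal.mk ↥(e '' nonCutPoints X)) ≤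
      Cardinal.lift.{v} (Cardinal.mk ↥(nonCutPoints X)) := Cardinal.mk_image_le_lift
    have h2 := h1.trans_lt (Cardinal.lift_lt.{u, v}.2 hX)
    rw [hE, ← Cardinal.lift_lt.{v, u}]
    simpa using h2
  have hD : IsDendron D := ⟨isDendritic_of_few_nonCutPoints
    (h.isEmbedding.isOpen_range_of_dense h.denseRange) h.isTotallyDisconnected hcard,
    inferInstance, inferInstance⟩
  have := hD.secondCountable
  exact ⟨hD, inferInstance⟩

end IsFreudenthalCompactification

/-! ### Descriptive set theory and category of the non-cut points. -/

/-- The set of non-cut points of a separable dendrite is a `Gδ`. -/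
theorem IsDendrite.isGδ_nonCutPoints [SeparableSpace X] (hX : IsDendrite X) :
    IsGδ (nonCutPoints X) := by
  have := hX.metrizable
  have := hX.connected
  have hD : IsDendritic X := hX.toIsDendritic
  obtain ⟨Q, hQc, hQd⟩ := exists_countable_dense X
  have := hQc.to_subtype
  have hGδ : ∀ p q : X, IsGδ {m | ¬ SeparatedByPoint p q m} := by
    intro p q
    -- The points failing to separate `p` from `q` form an open set together with `p` and `q`
    -- themselves, hence a Gδ.
    have heq : {m | ¬ SeparatedByPoint p q m} =
        {m | ∃ d V, IsSide d V ∧ p ∈ V ∧ q ∈ V ∧ m ∉ insert d V} ∪ {p, q} := by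
      ext m
      constructor
      · intro hm
        by_cases hpm : p = m
        · exact Or.inr (Or.inl hpm.symm)
        by_cases hqm : q = m
        · exact Or.inr (Or.inr hqm.symm)
        exact Or.inl (hD.exists_isSide_of_not_separated hpm hqm hm)
      · rintro (⟨d, V, hV, hp, hq, hm⟩ | hm) hsep
        · exact hm (hsep.mem_of_isPreconnected hV.isPreconnected_insert (mem_insert_of_mem _ hp)
            (mem_insert_of_mem _ hq))
        · obtain ⟨W, hW, hpW, hqW⟩ := separatedByPoint_iff.1 hsep
          rcases hm with rfl | rfl
          · exact hW.notMem hpW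
          · exact hqW (mem_insert _ _)
    rw [heq]
    refine IsGδ.union (IsOpen.isGδ ?_) ((toFinite {p, q}).isClosed.isGδ)
    rw [isOpen_iff_forall_mem_open]
    rintro m ⟨d, V, hV, hp, hq, hm⟩
    exact ⟨(insert d V)ᶜ, fun w hw => ⟨d, V, hV, hp, hq, hw⟩, hV.isClosed.isOpen_compl, hm⟩
  have heq : nonCutPoints X = ⋂ p : Q, ⋂ q : Q, {m | ¬ SeparatedByPoint (p : X) (q : X) m} := by
    ext m
    simp only [mem_iInter, mem_ofPred_eq]
    constructor
    · intro hm p q hsep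
      obtain ⟨V, hV, hp, hq⟩ := separatedByPoint_iff.1 hsep
      exact hm (mem_cutPoints_iff.2 ⟨V, hV, ⟨p, hp⟩, ⟨q, hq⟩⟩)
    · intro hm hcut
      obtain ⟨V, hV, hne, hne'⟩ := mem_cutPoints_iff.1 hcut
      obtain ⟨p, hpQ, hp⟩ := hQd.exists_mem_open hV.isOpen hne
      obtain ⟨q, hqQ, hq⟩ := hQd.exists_mem_open hV.compl.isOpen hne'
      exact hm ⟨p, hpQ⟩ ⟨q, hqQ⟩ (separatedByPoint_iff.2 ⟨V, hV, hp, hq⟩)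
  rw [heq]
  exact IsGδ.iInter fun p => IsGδ.iInter fun q => hGδ p q

/-- A `Gδ` subset of a compact metrizable space with fewer than continuum many points is
countable. -/
theorem IsGδ.countable_of_lt_continuum {X : Type u} [TopologicalSpace X] [CompactSpace X]
    [MetrizableSpace X] {s : Set X} (hs : IsGδ s)
    (hc : Cardinal.mk s < Cardinal.continuum.{u}) : s.Countable := by
  let := metrizableSpaceMetric X
  let : MeasurableSpace X := borel X
  have : BorelSpace X := ⟨rfl⟩
  have : StandardBorelSpace s := hs.measurableSet.standardBorel
  by_contra hcon
  have hcon' : ¬ Countable s := fun h => hcon (countable_coe_iff.1 h)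
  -- An uncountable standard Borel space is Borel isomorphic to ℝ, so it has continuum many points.
  have heq := Cardinal.mk_congr_lift (PolishSpace.measurableEquivOfNotCountable hcon'
    (not_countable (α := ℝ))).toEquiv
  rw [Cardinal.mk_real] at heq
  simp only [Cardinal.lift_uzero, Cardinal.lift_continuum] at heq
  exact hc.ne heq

/-- In a Baire space without isolated points, countable `Gδ` sets are nowhere dense. -/
theorem IsGδ.isNowhereDense_of_countable [BaireSpace X] [T1Space X]
    [∀ x : X, Filter.NeBot (nhdsWithin x {x}ᶜ)] {s : Set X} (hs : IsGδ s) (hc : s.Countable) :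
    IsNowhereDense s := by
  have h1 : Dense sᶜ := by
    rw [← biUnion_of_singleton s, compl_iUnion₂]
    exact dense_biInter_of_isOpen (fun x _ => isOpen_compl_singleton) hc
      fun x _ => dense_compl_singleton x
  have h2 : Dense (s ∪ (closure s)ᶜ) := by
    intro z
    by_cases hz : z ∈ closure s
    · exact closure_mono subset_union_left hz
    · exact subset_closure (Or.inr hz)
  -- Both sets are dense Gδ, and their intersection lies in the complement of `closure s`.
  have h3 := h2.inter_of_Gδ (hs.union isClosed_closure.isOpen_compl.isGδ) hc.isGδ_compl h1
  have h4 : Dense (closure s)ᶜ := h3.mono fun z hz => hz.1.resolve_left hz.2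
  exact interior_eq_empty_iff_dense_compl.2 h4

end

/-! ### Existence of the Freudenthal compactification. -/

section

variable (X : Type u) [TopologicalSpace X]

/-- The continuous functions to the unit interval which take only the values `0` and `1` outside
some compact set. -/
def EndFunctions : Type u :=
  {f : C(X, unitInterval) // ∃ K : Set X, IsCompact K ∧ ∀ x ∉ K, f x = 0 ∨ f x = 1}

/-- The evaluation map of a space into the cube indexed by `EndFunctions X`. -/
def endEval (x : X) : EndFunctions X → unitInterval := fun f => f.1 x

/-- The space of ends compactification, as the closure of the space in a cube. -/
abbrev EndCompactification : Type u := ↥(closure (range (endEval X)))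

/-- The canonical map of a space to its end compactification. -/
def toEndCompactification (x : X) : EndCompactification X :=
  ⟨endEval X x, subset_closure (mem_range_self x)⟩

variable {X}

theorem continuous_endEval : Continuous (endEval X) :=
  continuous_pi fun f => f.1.continuous

theorem continuous_toEndCompactification : Continuous (toEndCompactification X) :=
  continuous_endEval.subtype_mk _

theorem continuous_endCoordinate (f : EndFunctions X) :
    Continuous fun p : EndCompactification X => p.1 f :=
  (continuous_apply f).comp continuous_subtype_val

theorem denseRange_toEndCompactification : DenseRange (toEndCompactification X) := by
  intro p
  rw [closure_subtype, ← range_comp]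
  exact p.2

/-- A closed set with compact frontier is separated from any disjoint closed set by an end
function. -/
theorem exists_endFunction [LocallyCompactSpace X] [T2Space X] {A B : Set X} (hA : IsClosed A)
    (hB : IsClosed B) (hAB : Disjoint A B) (hfr : IsCompact (frontier A)) :
    ∃ f : EndFunctions X, (∀ x ∈ A, f.1 x = 0) ∧ ∀ x ∈ B, f.1 x = 1 := by
  classical
  obtain ⟨K, hK, hAK, hKB⟩ := exists_compact_between hfr hB.isOpen_compl
    (fun x hx => disjoint_left.1 hAB (hA.frontier_subset hx))
  obtain ⟨h, h0, h1, hI⟩ := exists_continuous_zero_one_of_isCompact hfr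
    (isOpen_interior (s := K)).isClosed_compl (disjoint_left.2 fun x hx hx' => hx' (hAK hx))
  let g : X → unitInterval := fun x => ⟨h x, hI x⟩
  have hg : Continuous g := h.continuous.subtype_mk _
  -- Extending by 0 over `A` is continuous because `h` vanishes on the frontier of `A`; intermediate
  -- values occur only in `K`, which misses `B`.
  have hf : Continuous (A.piecewise (fun _ => 0) g) := by
    refine Continuous.piecewise (fun x hx => ?_) continuous_const hg
    exact Subtype.ext (h0 hx).symm
  have hout : ∀ x ∉ A, x ∉ interior K → A.piecewise (fun _ => 0) g x = 1 := by
    intro x hxA hxK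
    rw [piecewise_eq_of_notMem _ _ _ hxA]
    exact Subtype.ext (h1 hxK)
  have hin : ∀ x ∈ A, A.piecewise (fun _ => 0) g x = 0 := fun x hx => piecewise_eq_of_mem _ _ _ hx
  refine ⟨⟨⟨_, hf⟩, K, hK, fun x hx => ?_⟩, hin,
    fun x hx => hout x (disjoint_right.1 hAB hx) fun h => hKB (interior_subset h) hx⟩
  by_cases hxA : x ∈ A
  · exact Or.inl (hin x hxA)
  · exact Or.inr (hout x hxA fun h => hx (interior_subset h))

theorem isEmbedding_toEndCompactification [LocallyCompactSpace X] [T2Space X] :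
    Topology.IsEmbedding (toEndCompactification X) := by
  have key : ∀ (x : X) (U : Set X), IsOpen U → x ∈ U →
      ∃ f : EndFunctions X, f.1 x = 0 ∧ ∀ y ∉ U, f.1 y = 1 := by
    intro x U hU hx
    obtain ⟨f, hf0, hf1⟩ := exists_endFunction (isClosed_singleton (x := x)) hU.isClosed_compl
      (disjoint_singleton_left.2 fun h => h hx)
      (isCompact_singleton.of_isClosed_subset isClosed_frontier isClosed_singleton.frontier_subset)
    exact ⟨f, hf0 x rfl, hf1⟩
  refine ⟨?_, fun x y hxy => ?_⟩
  · refine Topology.isInducing_iff_nhds.2 fun x => le_antisymm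
      continuous_toEndCompactification.continuousAt.le_comap ?_
    intro U hU
    obtain ⟨V, hVU, hV, hxV⟩ := mem_nhds_iff.1 hU
    obtain ⟨f, hf0, hf1⟩ := key x V hV hxV
    refine ⟨{p | p.1 f ≠ 1}, ?_, ?_⟩
    · refine IsOpen.mem_nhds (isOpen_compl_singleton.preimage (continuous_endCoordinate f)) ?_
      change f.1 x ≠ 1
      rw [hf0]
      exact zero_ne_one
    · intro y hy
      by_contra hyU
      exact hy (hf1 y fun h => hyU (hVU h))
  · by_contra hne
    obtain ⟨f, hf0, hf1⟩ := key x {y}ᶜ isOpen_compl_singleton hne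
    have h1 : f.1 y = 1 := hf1 y fun h => h rfl
    have h2 : f.1 x = f.1 y := congrArg (fun p : EndCompactification X => p.1 f) hxy
    rw [hf0, h1] at h2
    exact zero_ne_one h2

/-- The image of `K` is compact, hence closed, so a limit of the image of `X` lies in it or inherits
the value 0 or 1. These two-valued coordinates make the remainder zero-dimensional. -/
theorem endCoordinate_eq_zero_or_one {p : EndCompactification X}
    (hp : p ∉ range (toEndCompactification X)) (f : EndFunctions X) : p.1 f = 0 ∨ p.1 f = 1 := by
  obtain ⟨K, hK, hf⟩ := f.2
  have hsub : range (toEndCompactification X) ⊆ toEndCompactification X '' K ∪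
      {p | p.1 f = 0 ∨ p.1 f = 1} := by
    rintro _ ⟨x, rfl⟩
    by_cases hx : x ∈ K
    · exact Or.inl ⟨x, hx, rfl⟩
    · exact Or.inr (hf x hx)
  have hcl : IsClosed (toEndCompactification X '' K ∪
      {p : EndCompactification X | p.1 f = 0 ∨ p.1 f = 1}) :=
    (hK.image continuous_toEndCompactification).isClosed.union
      ((isClosed_singleton.preimage (continuous_endCoordinate f)).union
        (isClosed_singleton.preimage (continuous_endCoordinate f)))
  rcases closure_minimal hsub hcl (denseRange_toEndCompactification p) with h | h
  · exact absurd (image_subset_range _ _ h) hp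
  · exact h

theorem isFreudenthalCompactification_toEndCompactification [LocallyCompactSpace X] [T2Space X] :
    IsFreudenthalCompactification (toEndCompactification X) := by
  have hD : CompactSpace (EndCompactification X) :=
    isCompact_iff_compactSpace.1 isClosed_closure.isCompact
  refine ⟨hD, inferInstance, isEmbedding_toEndCompactification, denseRange_toEndCompactification,
    ?_, fun A B hA hB hAB hfA _ => ?_⟩
  · have hR : IsClosed (range (toEndCompactification X))ᶜ :=
      (isEmbedding_toEndCompactification.isOpen_range_of_dense
        denseRange_toEndCompactification).isClosed_compl
    have : CompactSpace ↥(range (toEndCompactification X))ᶜ :=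
      isCompact_iff_compactSpace.1 hR.isCompact
    have : TotallySeparatedSpace ↥(range (toEndCompactification X))ᶜ := by
      refine totallySeparatedSpace_iff_exists_isClopen.2 fun p q hpq => ?_
      have hpq' : p.1.1 ≠ q.1.1 := fun h => hpq (Subtype.ext (Subtype.ext h))
      obtain ⟨f, hf⟩ := Function.ne_iff.1 hpq'
      have hc : Continuous fun r : ↥(range (toEndCompactification X))ᶜ => r.1.1 f :=
        (continuous_endCoordinate f).comp continuous_subtype_val
      have hcl : ∀ t : unitInterval, IsClosed {r : ↥(range (toEndCompactification X))ᶜ |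
          r.1.1 f = t} := fun t => isClosed_singleton.preimage hc
      have hcompl : {r : ↥(range (toEndCompactification X))ᶜ | r.1.1 f = 0}ᶜ =
          {r | r.1.1 f = 1} := by
        ext r
        constructor
        · exact fun h => (endCoordinate_eq_zero_or_one r.2 f).resolve_left h
        · intro h h'
          exact zero_ne_one ((show r.1.1 f = 0 from h').symm.trans h)
      have hclopen : IsClopen {r : ↥(range (toEndCompactification X))ᶜ | r.1.1 f = 0} :=
        ⟨hcl 0, by rw [← isClosed_compl_iff, hcompl]; exact hcl 1⟩
      by_cases hp : p.1.1 f = 0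
      · exact ⟨_, hclopen, hp, fun hq => hf (hp.trans (show q.1.1 f = 0 from hq).symm)⟩
      · refine ⟨_, hclopen.compl, hp, fun hq => hq ?_⟩
        have h1 := (endCoordinate_eq_zero_or_one p.2 f).resolve_left hp
        exact (endCoordinate_eq_zero_or_one q.2 f).resolve_right fun h => hf (h1.trans h.symm)
    exact isTopologicalBasis_isClopen
  · obtain ⟨f, hf0, hf1⟩ := exists_endFunction hA hB hAB hfA
    have key : ∀ (S : Set X) (t : unitInterval), (∀ x ∈ S, f.1 x = t) →
        ∀ p ∈ closure (toEndCompactification X '' S), p.1 f = t := by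
      intro S t ht p hp
      refine closure_minimal ?_ (isClosed_singleton.preimage (continuous_endCoordinate f)) hp
      rintro _ ⟨x, hx, rfl⟩
      exact ht x hx
    exact disjoint_left.2 fun p hpA hpB =>
      zero_ne_one ((key A 0 hf0 p hpA).symm.trans (key B 1 hf1 p hpB))

end

/-! ### The main theorem. -/

theorem theorem1p1 (X : Type u) [TopologicalSpace X] [ConnectedSpace X] [SeparableSpace X]
    [LocallyCompactSpace X] [T2Space X]
    (hX : Cardinal.mk ↥(nonCutPoints X) < Cardinal.continuum.{u}) :
    -- (i) the Freudenthal compactification of `X` exists and is a dendrite with the same cut points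
    (∃ (D : Type u) (_ : TopologicalSpace D) (e : X → D),
      IsFreudenthalCompactification e ∧ IsDendrite D ∧ cutPoints D = e '' cutPoints X) ∧
    (∀ (D : Type v) [TopologicalSpace D] (e : X → D),
      IsFreudenthalCompactification e → IsDendrite D ∧ cutPoints D = e '' cutPoints X) ∧
    -- (ii) the set of non-cut points
    IsGδ (nonCutPoints X) ∧ (Nontrivial X → IsNowhereDense (nonCutPoints X)) := by
  have he : IsFreudenthalCompactification (toEndCompactification X) :=
    isFreudenthalCompactification_toEndCompactification
  have hD := he.isDendrite hX
  have hcont := he.isEmbedding.continuous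
  have hinj := he.isEmbedding.injective
  have := he.compact
  have := hD.metrizable
  have : SeparableSpace (EndCompactification X) := he.denseRange.separableSpace hcont
  have hGδ := hD.isGδ_nonCutPoints
  have hpre : toEndCompactification X ⁻¹' nonCutPoints (EndCompactification X) =
      nonCutPoints X := by
    rw [nonCutPoints, he.cutPoints_eq, preimage_compl, hinj.preimage_image, nonCutPoints]
  have himg : toEndCompactification X '' nonCutPoints X =
      nonCutPoints (EndCompactification X) ∩ range (toEndCompactification X) := by
    rw [← hpre, image_preimage_eq_inter_range]
  have hGδX : IsGδ (nonCutPoints X) := hpre ▸ hGδ.preimage hcont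
  refine ⟨⟨_, _, _, he, hD, he.cutPoints_eq⟩, fun E _ e h => ⟨h.isDendrite hX, h.cutPoints_eq⟩,
    -- Local compactness makes `X` a Baire space, and a nontrivial connected Hausdorff space has no
    -- isolated points, so only countability remains.
    hGδX, fun _ => hGδX.isNowhereDense_of_countable ?_⟩
  -- Countability is proved in the compact metrizable space `EndCompactification X`, where the image
  -- is a Gδ because the range of the embedding is open.
  have hcount : (toEndCompactification X '' nonCutPoints X).Countable := by
    refine IsGδ.countable_of_lt_continuum ?_ (Cardinal.mk_image_le.trans_lt hX)
    rw [himg]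
    exact hGδ.inter (he.isEmbedding.isOpen_range_of_dense he.denseRange).isGδ
  exact countable_of_injective_of_countable_image hinj.injOn hcount
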